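/- Let $F\subseteq K\subseteq L$ be fields and let $\sigma$ be an automorphism of $L$. Call the triple $(F,K,L)$ $\sigma$-admissible if $\sigma$ restricts to automorphisms of $F$ and of $K$, if $F=F^\sigma=K^\sigma=L^\sigma$ (superscript $\sigma$ denoting the elements fixed by $\sigma$), and if $L$ is a (not necessarily algebraic) separable extension of $K$. Assume that $(F,K,L)$ is $\sigma$-admissible. Let $r\ge 0$, $\Phi\in \mathrm{GL}_r(K)$, and let $\Psi\in\mathrm{GL}_r(L)$ satisfy $\sigma(\Psi)=\Phi\Psi$. Put $\Sigma=K[\Psi,1/\det\Psi]\subseteq L$ and $Z=\operatorname{Spec}\Sigma$, and let $\Lambda=K(\Psi)$ be the fraction field of $\Sigma$. Let $\mathfrak q$ be the kernel of the $F$-algebra map $F[X,1/\det X]\to L\otimes_K L$, $X\mapsto\Psi_1^{-1}\Psi_2$, where $(\Psi_1)_{ij}=\Psi_{ij}\otimes 1$ and $(\Psi_2)_{ij}=1\otimes\Psi_{ij}$, and let $\Gamma=\operatorname{Spec}(F[X,1/\det X]/\mathfrak q)\subseteq\mathrm{GL}_{r/F}$. Assume that $K$ is algebraically closed in $\Lambda$.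 Let $\overline L$ be an algebraic closure of $L$, let $\overline F$ and $\overline K$ be the algebraic closures of $F$ and $K$ in $\overline L$, fix an extension of $\sigma$ to an automorphism of $\overline L$, again denoted $\sigma$, and for $n\ge1$ put $\mathbf F_n=\overline L^{\sigma^n}$. Suppose that $(\mathbf F_n,\overline K,\overline L)$ is $\sigma^n$-admissible for every $n\ge 1$ and that $\overline F=\bigcup_{n\ge1}\mathbf F_n$. Then the natural map $\overline K\otimes_K\Sigma\to\overline L$ is injective, so that the coordinate ring $\widetilde\Sigma$ of $Z_{\overline K}$ and its fraction field $\widetilde\Lambda$ may be regarded as subrings of $\overline L$. For every $\gamma\in\Gamma(\overline F)$ there is a unique automorphism of $\widetilde\Lambda$ over $\overline K$ that sends the matrix $\Psi$ to $\Psi\gamma$. With respect to these automorphisms: (a) the subfield of $\widetilde\Lambda$ fixed by $\Gamma(\overline F)$ is $\overline K$; (b) the elements of $\Lambda\subseteq\widetilde\Lambda$ fixed by $\Gamma(\overline F)$ are precisely those of $K$. -/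

import Mathlib

open scoped TensorProduct

noncomputable section

namespace DifferenceGalois

/-! ### Fixed fields and admissible triples -/

/-- The subfield `E^σ` of elements of `E` fixed by `σ`. -/
def fixedSubfield {E : Type*} [Field E] (σ : E ≃+* E) : Subfield E :=
  RingHom.eqLocusField (σ : E →+* E) (RingHom.id E)

/-- The triple `(F, K, E)` of fields `F ⊆ K ⊆ E` is `σ`-admissible for the automorphism `σ` of `E`.
Here `E` need not be algebraic over `K`; separability of `E / K` is taken in the general sense, that
`E` stays reduced after every extension of the base field `K`. -/
structure IsAdmissible {E : Type*} [Field E] (σ : E ≃+* E) (F K : Subfield E) : Prop where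
  le : F ≤ K
  map_F : F.map (σ : E →+* E) = F
  map_K : K.map (σ : E →+* E) = K
  fixed_F : F ⊓ fixedSubfield σ = F
  fixed_K : K ⊓ fixedSubfield σ = F
  fixed_E : fixedSubfield σ = F
  separable : Algebra.IsGeometricallyReduced K E

/-! ### The coordinate ring of `GL_r` -/

/-- The coordinate ring `R[X, 1 / det X]` of `GL_r` over `R`. -/
abbrev GLRing (R : Type*) [CommRing R] (r : ℕ) : Type _ :=
  Localization.Away (Matrix.mvPolynomialX (Fin r) (Fin r) R).det

theorem isUnit_aeval_det {R S : Type*} [CommRing R] [CommRing S] [Algebra R S] {r : ℕ}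
    (g : GL (Fin r) S) :
    IsUnit (MvPolynomial.aeval (R := R) (fun p : Fin r × Fin r => g p.1 p.2)
      (Matrix.mvPolynomialX (Fin r) (Fin r) R).det) := by
  have h : MvPolynomial.aeval (R := R) (fun p : Fin r × Fin r => g p.1 p.2)
      (Matrix.mvPolynomialX (Fin r) (Fin r) R).det = (g : Matrix (Fin r) (Fin r) S).det := by
    rw [AlgHom.map_det]
    congr 1
    ext i j
    simp [Matrix.mvPolynomialX]
  rw [h]
  exact (Matrix.isUnit_iff_isUnit_det _).mp g.isUnit

/-- The `R`-algebra map `R[X, 1 / det X] → S`, `h ↦ h(g)`, for a point `g ∈ GL_r(S)`. -/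
def evalGL (R : Type*) {S : Type*} [CommRing R] [CommRing S] [Algebra R S] {r : ℕ}
    (g : GL (Fin r) S) : GLRing R r →ₐ[R] S :=
  IsLocalization.Away.liftAlgHom (A := R) (S := GLRing R r)
    (Matrix.mvPolynomialX (Fin r) (Fin r) R).det
    (f := MvPolynomial.aeval (R := R) (fun p : Fin r × Fin r => g p.1 p.2)) (isUnit_aeval_det g)

/-- `evalGL` sends the variable `X i j` to the entry `g i j`. -/
theorem evalGL_X {R S : Type*} [CommRing R] [CommRing S] [Algebra R S] {r : ℕ}
    (g : GL (Fin r) S) (i j : Fin r) :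
    evalGL R g (algebraMap (MvPolynomial (Fin r × Fin r) R) (GLRing R r)
      (MvPolynomial.X (i, j))) = g i j := by
  have h := IsLocalization.Away.lift_eq (S := GLRing R r)
    (Matrix.mvPolynomialX (Fin r) (Fin r) R).det
    (g := (MvPolynomial.aeval (R := R) (fun p : Fin r × Fin r => g p.1 p.2)).toRingHom)
    (isUnit_aeval_det g) (MvPolynomial.X (i, j))
  exact h.trans (by simp)

section

variable {L : Type*} [Field L] (F K : Subfield L) {r : ℕ} (Ψ : GL (Fin r) L)

/-- `Ψ ∈ GL_r(L)` is a fundamental matrix for `Φ ∈ GL_r(K)`: `σ(Ψ) = Φ Ψ`. -/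
def IsFundamental (σ : L ≃+* L) (Φ : GL (Fin r) K) : Prop :=
  Matrix.GeneralLinearGroup.map (σ : L →+* L) Ψ =
    Matrix.GeneralLinearGroup.map K.subtype Φ * Ψ

/-! ### The scheme `Z` and the field `Λ` -/

/-- `Σ = K[Ψ, 1 / det Ψ] ⊆ L`, the image of `ν : K[X, 1 / det X] → L`, `X ↦ Ψ`; it is the
coordinate ring of `Z = Spec Σ`. -/
def sigmaRing : Subalgebra K L := (evalGL K Ψ).range

/-- `Λ = K(Ψ)`, the fraction field of `Σ` inside `L`. -/
def lambdaField : IntermediateField K L :=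
  IntermediateField.adjoin K (sigmaRing K Ψ : Set L)

/-! ### The Galois group `Γ` -/

/-- The matrix `Ψ₁⁻¹ Ψ₂ ∈ GL_r(L ⊗_K L)`, where `Ψ₁` has entries `Ψ i j ⊗ 1` and `Ψ₂` has
entries `1 ⊗ Ψ i j`. -/
def psiTwist : GL (Fin r) (L ⊗[K] L) :=
  (Matrix.GeneralLinearGroup.map
      (Algebra.TensorProduct.includeLeft : L →ₐ[K] L ⊗[K] L).toRingHom Ψ)⁻¹ *
    Matrix.GeneralLinearGroup.map
      (Algebra.TensorProduct.includeRight : L →ₐ[K] L ⊗[K] L).toRingHom Ψ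

/-- The ideal `𝔮 ⊆ F[X, 1 / det X]` of `Γ ⊆ GL_r`: the kernel of
`μ : F[X, 1 / det X] → L ⊗_K L`, `X ↦ Ψ₁⁻¹ Ψ₂`. -/
def galoisIdeal : Ideal (GLRing F r) := RingHom.ker (evalGL F (psiTwist K Ψ))

/-- The set `Γ(S) ⊆ GL_r(S)` of points of `Γ = Spec (F[X, 1 / det X] / 𝔮)` in an
`F`-algebra `S`. -/
def galoisPoints (S : Type*) [CommRing S] [Algebra F S] : Set (GL (Fin r) S) :=
  {γ | ∀ h ∈ galoisIdeal F K Ψ, evalGL F γ h = 0}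

/-! ### Base extension to the algebraic closure `M` of `L` -/

variable (M : Type*) [Field M] [Algebra L M]

/-- The natural map from the coordinate ring `K̄ ⊗_K Σ` of `Z_{K̄}` to `M`, where `K̄` is
the algebraic closure of `K` in `M`. -/
def sigmaTildeMap : (algebraicClosure K M) ⊗[K] (sigmaRing K Ψ) →ₐ[algebraicClosure K M] M :=
  Algebra.TensorProduct.lift (Algebra.ofId (algebraicClosure K M) M)
    ((IsScalarTower.toAlgHom K L M).comp (sigmaRing K Ψ).val) (fun _ _ => Commute.all _ _)

/-- The coordinate ring of `Z_{K̄}` considered as a subring of `M`. -/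
def sigmaTilde : Subalgebra (algebraicClosure K M) M := (sigmaTildeMap K Ψ M).range

/-- The fraction field of `sigmaTilde` inside `M`. -/
def lambdaTilde : IntermediateField (algebraicClosure K M) M :=
  IntermediateField.adjoin (algebraicClosure K M) (sigmaTilde K Ψ M : Set M)

theorem algebraMap_mem_lambdaTilde {x : L} (hx : x ∈ lambdaField K Ψ) :
    algebraMap L M x ∈ lambdaTilde K Ψ M := by
  have h : lambdaField K Ψ ≤
      ((lambdaTilde K Ψ M).restrictScalars K).comap (IsScalarTower.toAlgHom K L M) := by
    refine IntermediateField.adjoin_le_iff.mpr fun y hy => ?_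
    refine IntermediateField.subset_adjoin (algebraicClosure K M) _ ?_
    exact ⟨1 ⊗ₜ ⟨y, hy⟩, by simp [sigmaTildeMap]⟩
  exact h hx

/-- The inclusion `Λ ⊆ Λ̃`. -/
def lambdaIncl : lambdaField K Ψ →+* lambdaTilde K Ψ M :=
  ((algebraMap L M).comp (algebraMap (lambdaField K Ψ) L)).codRestrict (lambdaTilde K Ψ M)
    fun x => algebraMap_mem_lambdaTilde K Ψ M x.2

theorem psi_mem_lambdaField (i j : Fin r) : Ψ i j ∈ lambdaField K Ψ :=
  IntermediateField.subset_adjoin K _ ⟨_, evalGL_X (R := K) Ψ i j⟩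

/-- The matrix `Ψ` with its entries regarded as elements of `Λ̃`. -/
def psiTilde : Matrix (Fin r) (Fin r) (lambdaTilde K Ψ M) :=
  Matrix.of fun i j => lambdaIncl K Ψ M ⟨Ψ i j, psi_mem_lambdaField K Ψ i j⟩

/-- The automorphism `τ` of `Λ̃ / K̄` is induced by `γ ∈ GL_r(F̄)`: on `Σ̃` it is
`h(Ψ) ↦ h(Ψ γ)`, that is, it sends the matrix `Ψ` to `Ψ γ`. -/
def IsInducedBy (γ : GL (Fin r) (algebraicClosure F M))
    (τ : lambdaTilde K Ψ M ≃ₐ[algebraicClosure K M] lambdaTilde K Ψ M) : Prop :=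
  (psiTilde K Ψ M).map (fun f => ((τ f : lambdaTilde K Ψ M) : M)) =
    (Ψ : Matrix (Fin r) (Fin r) L).map (algebraMap L M) *
      (γ : Matrix (Fin r) (Fin r) (algebraicClosure F M)).map
        (algebraMap (algebraicClosure F M) M)

/-- `act` is the action of `Γ(F̄)` on `Λ̃`. -/
def IsGaloisAction
    (act : galoisPoints F K Ψ (algebraicClosure F M) →
      (lambdaTilde K Ψ M ≃ₐ[algebraicClosure K M] lambdaTilde K Ψ M)) : Prop :=
  ∀ γ, IsInducedBy F K Ψ M γ.1 (act γ)

end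

end DifferenceGalois

end

/-!
Write `K̄`, `F̄` for the algebraic closures in `M`, and `Σ̃`, `Λ̃` for `sigmaTilde`, `lambdaTilde`. The
proof rests on two comparisons.

*The torsor.* Let `B` be the coordinate ring of `Γ`, embedded in `L ⊗[K] L` by `X ↦ Ψ₁⁻¹ Ψ₂`. Since
`σ(Ψ) = Φ Ψ` with `Φ` over `K`, the matrix `Ψ₁⁻¹ Ψ₂` is fixed by `σ ⊗ σ`, hence so is `B`. Vectors
fixed by a `σ`-semilinear map that are independent over `F = L^σ` are independent over `L`
(`linearIndependent_of_fixed`), so `L ⊗[F] B → L ⊗[K] L` is injective (`galoisRing_lift_injective`).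
It maps `Ψ γ`, for the universal point `γ` of `Γ`, to `Ψ₂`, so every equation over `K` that holds at
`Ψ` holds at `Ψ γ` (`evalGL_tensorMul_universalPoint_eq_zero`).

*Base change.* The extension `Λ / K` is regular: `K` is algebraically closed in `Λ`, and `Λ / K` is
separable. Hence `K̄ ⊗[K] Λ → M` is injective (`lift_injective_of_isAlgebraic`), so `Σ̃` is
`K̄ ⊗[K] Σ`, and `Ψ ↦ Ψ γ` defines a coaction `ρ : Σ̃ → M ⊗[F] B` (`exists_coaction`). Its
specializations at the points `γ ∈ Γ(F̄)` are endomorphisms of `Σ̃`, because `F̄ ⊆ K̄`. They are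
surjective, hence bijective because `Σ̃` is noetherian, and extend to the fraction field `Λ̃`.

For the fixed field, let `f = a / b` be fixed by `Γ(F̄)`, with `a, b ∈ Σ̃`. Then `ρ(a) b - a ρ(b)`
vanishes at all `F̄`-points of `Γ`, so it is nilpotent by the Nullstellensatz
(`isNilpotent_of_forall_point_eq_zero`). The homomorphism `M ⊗[F] B → M ⊗[K̄] M`, `γ ↦ Ψ₁⁻¹ Ψ₂`, maps
it to `b ⊗ a - a ⊗ b`. If `f` were transcendental over `K̄`, this element would not be nilpotent
(`isAlgebraic_div_of_isNilpotent`); so `f ∈ K̄`. An element of `Λ` that lies in `K̄` is algebraic over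
`K`, hence in `K`.
-/

noncomputable section

namespace DifferenceGalois

/-! ### Linear disjointness of algebraic and regular extensions -/

section Regular

variable {K Λ M : Type*} [Field K] [Field Λ] [Field M] [Algebra K Λ] [Algebra Λ M] [Algebra K M]
  [IsScalarTower K Λ M]

/-- The minimal polynomial over `K` stays irreducible over `Λ`, since the coefficients of a monic
factor are algebraic over `K`. -/
theorem minpoly_map_eq_of_algebraicClosure_eq_bot (hK : algebraicClosure K Λ = ⊥) {x : M}
    (hx : IsIntegral K x) : (minpoly K x).map (algebraMap K Λ) = minpoly Λ x := by
  have hxΛ : IsIntegral Λ x := hx.tower_top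
  have hc : ∀ i, (minpoly Λ x).coeff i ∈ Set.range (algebraMap K Λ) := fun i => by
    have h : IsIntegral K ((minpoly Λ x).coeff i) :=
      Polynomial.isIntegral_coeff_of_dvd (minpoly K x) _ (minpoly.monic hx) (minpoly.monic hxΛ)
        (minpoly.dvd_map_of_isScalarTower K Λ x) i
    have h' : (minpoly Λ x).coeff i ∈ algebraicClosure K Λ :=
      mem_algebraicClosure_iff.mpr h.isAlgebraic
    rw [hK] at h'
    exact IntermediateField.mem_bot.mp h'
  obtain ⟨p, hp, -, hpm⟩ := Polynomial.lifts_and_natDegree_eq_and_monic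
    ((Polynomial.lifts_iff_coeff_lifts _).mpr hc) (minpoly.monic hxΛ)
  have hp0 : Polynomial.aeval x p = 0 := by
    rw [← Polynomial.aeval_map_algebraMap Λ, hp, minpoly.aeval]
  have h1 := Polynomial.map_dvd (algebraMap K Λ) (minpoly.dvd K x hp0)
  rw [hp] at h1
  exact Polynomial.eq_of_monic_of_associated ((minpoly.monic hx).map _) (minpoly.monic hxΛ)
    (associated_of_dvd_dvd h1 (minpoly.dvd_map_of_isScalarTower K Λ x))

/-- Finite subextensions have a primitive element, whose powers stay independent over `Λ` because its
minimal polynomial does not change. -/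
theorem linearDisjoint_of_isSeparable (hK : algebraicClosure K Λ = ⊥) (S : IntermediateField K M)
    [Algebra.IsSeparable K S] : S.LinearDisjoint Λ := by
  refine Subalgebra.LinearDisjoint.of_linearDisjoint_finite_left _ _ fun A hA hfin => ?_
  have hint : ∀ x ∈ A, IsIntegral K x := fun x hx =>
    (Algebra.IsIntegral.isIntegral (R := K) (⟨x, hx⟩ : A)).map A.val
  let A' : IntermediateField K M := A.toIntermediateField fun x hx =>
    A.inv_mem_of_algebraic (x := ⟨x, hx⟩)
      (hint x hx).isAlgebraic
  have : FiniteDimensional K A' := hfin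
  have : Algebra.IsSeparable K A' := Algebra.IsSeparable.of_algHom K S
    (IntermediateField.inclusion (show A' ≤ S from hA))
  obtain ⟨α, hα⟩ := Field.exists_primitive_element K A'
  have hαi : IsIntegral K α := Algebra.IsIntegral.isIntegral α
  let pb := PowerBasis.ofAdjoinEqTop' hαi (by
    rw [← IntermediateField.adjoin_simple_toSubalgebra_of_isAlgebraic hαi.isAlgebraic, hα]
    simp)
  show A'.LinearDisjoint Λ
  refine IntermediateField.LinearDisjoint.of_basis_left pb.basis ?_
  have hmp : minpoly K (α : M) = minpoly K α :=
    minpoly.algHom_eq A'.val A'.val.injective α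
  have hdim : pb.dim = (minpoly Λ (α : M)).natDegree := by
    have hαM : IsIntegral K (α : M) := hαi.map A'.val
    rw [← minpoly_map_eq_of_algebraicClosure_eq_bot (Λ := Λ) hK hαM, Polynomial.natDegree_map,
      hmp, PowerBasis.ofAdjoinEqTop'_dim]
  have hli := linearIndependent_pow (K := Λ) (α : M)
  rw [← hdim] at hli
  convert hli using 1
  ext i
  rw [Function.comp_apply, pb.basis_eq_pow]
  simp [pb]

variable {S : Type*} [Field S] [Algebra K S] [Algebra S M] [IsScalarTower K S M]

theorem lift_injective_of_isSeparable (hK : algebraicClosure K Λ = ⊥) [Algebra.IsSeparable K S] :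
    Function.Injective (Algebra.TensorProduct.productMap (IsScalarTower.toAlgHom K S M)
      (IsScalarTower.toAlgHom K Λ M)) := by
  have : Algebra.IsSeparable K (IsScalarTower.toAlgHom K S M).fieldRange :=
    Algebra.IsSeparable.of_algHom K S
      (AlgEquiv.ofInjectiveField (IsScalarTower.toAlgHom K S M)).symm.toAlgHom
  have h := linearDisjoint_of_isSeparable hK (IsScalarTower.toAlgHom K S M).fieldRange
  have hm : Function.Injective (Subalgebra.mulMap
      (IsScalarTower.toAlgHom K S M).fieldRange.toSubalgebra
      (IsScalarTower.toAlgHom K Λ M).range) := h.injective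
  let e := Algebra.TensorProduct.congr
    (AlgEquiv.ofInjectiveField (IsScalarTower.toAlgHom K S M))
    (AlgEquiv.ofInjectiveField (IsScalarTower.toAlgHom K Λ M))
  have he : Algebra.TensorProduct.productMap (IsScalarTower.toAlgHom K S M)
      (IsScalarTower.toAlgHom K Λ M) = (Subalgebra.mulMap
      (IsScalarTower.toAlgHom K S M).fieldRange.toSubalgebra
      (IsScalarTower.toAlgHom K Λ M).range).comp e.toAlgHom := by
    exact Algebra.TensorProduct.ext' fun a b => rfl
  rw [he]
  exact hm.comp e.injective

/-- A regular extension `Λ` of `K` is linearly disjoint from every algebraic extension `E` of `K`.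
A power of an element of `E ⊗[K] Λ` comes from the separable part of `E`, where algebraic
closedness of `K` in `Λ` suffices, and reducedness takes care of the power. -/
theorem lift_injective_of_isAlgebraic (hK : algebraicClosure K Λ = ⊥)
    [Algebra.IsGeometricallyReduced K Λ] [Algebra.IsAlgebraic K S] :
    Function.Injective (Algebra.TensorProduct.productMap (IsScalarTower.toAlgHom K S M)
      (IsScalarTower.toAlgHom K Λ M)) := by
  let S₀ := separableClosure K S
  have : IsScalarTower K S₀ M := IsScalarTower.of_algebraMap_eq fun x =>
    IsScalarTower.algebraMap_apply K S M x
  rw [injective_iff_map_eq_zero]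
  intro x hx
  let e := (Algebra.TensorProduct.comm S₀ (S₀ ⊗[K] Λ) S).trans
    (Algebra.TensorProduct.cancelBaseChange K S₀ S₀ S Λ)
  obtain ⟨n, hn, y, hy⟩ := IsPurelyInseparable.exists_pow_mem_range_tensorProduct
    (k := S₀) (K := S) (R := S₀ ⊗[K] Λ) (e.symm x)
  have hy' : x ^ n = e (y ⊗ₜ 1) := by
    rw [show y ⊗ₜ[S₀] (1 : S) = e.symm x ^ n from hy, map_pow, e.apply_symm_apply]
  have key : ∀ z : S₀ ⊗[K] Λ, Algebra.TensorProduct.productMap (IsScalarTower.toAlgHom K S M)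
      (IsScalarTower.toAlgHom K Λ M) (e (z ⊗ₜ 1)) =
      Algebra.TensorProduct.productMap (IsScalarTower.toAlgHom K S₀ M)
        (IsScalarTower.toAlgHom K Λ M) z := by
    intro z
    induction z using TensorProduct.induction_on with
    | zero => simp
    | tmul a b =>
      simp [e, Algebra.smul_def, IsScalarTower.algebraMap_apply S₀ S M]
    | add u v hu hv => rw [TensorProduct.add_tmul, map_add, map_add, map_add, hu, hv]
  have hy0 : y = 0 := by
    apply (injective_iff_map_eq_zero _).mp
      (lift_injective_of_isSeparable (M := M) (S := S₀) hK)
    rw [← key, ← hy', map_pow, hx, zero_pow hn.ne']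
  rw [hy0, TensorProduct.zero_tmul, map_zero] at hy'
  exact eq_zero_of_pow_eq_zero hy'

end Regular

/-! ### Descent along the fixed field of an automorphism -/

section Descent

variable {F L T : Type*} [Field F] [Field L] [Algebra F L] [AddCommGroup T] [Module F T]
  [Module L T] [IsScalarTower F L T]

/-- Vectors fixed by a `σ`-semilinear map that are linearly independent over `L^σ` are linearly
independent over `L`. -/
theorem linearIndependent_of_fixed (σ : L →+* L)
    (hσ : ∀ x, σ x = x → x ∈ Set.range (algebraMap F L)) (s : T →ₛₗ[σ] T) {ι : Type*} {v : ι → T}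
    (hs : ∀ i, s (v i) = v i) (hv : LinearIndependent F v) : LinearIndependent L v := by
  classical
  rw [linearIndependent_iff]
  -- a shortest relation with a coefficient `1` is fixed by `σ`, so it is a relation over `F`
  suffices h : ∀ n : ℕ, ∀ l : ι →₀ L, l.support.card = n →
      Finsupp.linearCombination L v l = 0 → l = 0 from fun l hl => h _ l rfl hl
  intro n
  induction n using Nat.strong_induction_on with
  | _ n ih =>
    intro l hn hl
    by_contra hne
    obtain ⟨i₀, hi₀⟩ := Finsupp.ne_iff.mp hne
    simp only [Finsupp.coe_zero, Pi.zero_apply] at hi₀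
    let k : ι →₀ L := (l i₀)⁻¹ • l
    have hk0 : Finsupp.linearCombination L v k = 0 := by simp [k, hl]
    have hk1 : k i₀ = 1 := by simp [k, hi₀]
    have hksupp : k.support = l.support := by
      ext i; simp [k, hi₀]
    let kσ : ι →₀ L := k.mapRange σ (map_zero σ)
    have hkσ0 : Finsupp.linearCombination L v kσ = 0 := by
      have h := congrArg s hk0
      rw [map_zero, Finsupp.linearCombination_apply, Finsupp.sum, map_sum] at h
      rw [Finsupp.linearCombination_apply, Finsupp.sum_mapRange_index (by simp), Finsupp.sum, ← h]
      simp [hs]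
    have hfix : kσ - k = 0 := by
      refine ih _ ?_ (kσ - k) rfl (by rw [map_sub, hk0, hkσ0, sub_zero])
      rw [← hn, ← hksupp]
      refine Finset.card_lt_card ⟨fun i hi => ?_, fun h => ?_⟩
      · rw [Finsupp.mem_support_iff] at hi ⊢
        intro h
        simp [kσ, h] at hi
      · have := h (show i₀ ∈ k.support by simp [hk1])
        simp [kσ, hk1] at this
    have hmem : ∀ i, ∃ c : F, algebraMap F L c = k i := fun i => by
      apply hσ
      have := DFunLike.congr_fun hfix i
      simpa [kσ, sub_eq_zero] using this
    choose c hc using hmem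
    have hc0 : Finsupp.linearCombination F v (k.mapRange (Function.invFun (algebraMap F L))
        (by rw [← map_zero (algebraMap F L),
          Function.leftInverse_invFun (algebraMap F L).injective])) = 0 := by
      rw [← hk0, Finsupp.linearCombination_apply, Finsupp.linearCombination_apply,
        Finsupp.sum_mapRange_index (by simp)]
      refine Finsupp.sum_congr fun i _ => ?_
      rw [← hc i, Function.leftInverse_invFun (algebraMap F L).injective, algebraMap_smul]
    have := DFunLike.congr_fun (linearIndependent_iff.mp hv _ hc0) i₀
    rw [Finsupp.mapRange_apply, hk1, ← map_one (algebraMap F L),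
      Function.leftInverse_invFun (algebraMap F L).injective] at this
    exact one_ne_zero this

/-- An injective `F`-linear map into the vectors fixed by a `σ`-semilinear map, `F = L^σ`, stays
injective after extending scalars to `L`. -/
theorem liftBaseChange_injective_of_fixed (σ : L →+* L)
    (hσ : ∀ x, σ x = x → x ∈ Set.range (algebraMap F L)) (s : T →ₛₗ[σ] T)
    {B : Type*} [AddCommGroup B] [Module F B] (μ : B →ₗ[F] T) (hμ : Function.Injective μ)
    (hs : ∀ b, s (μ b) = μ b) : Function.Injective (μ.liftBaseChange L) := by
  let b := Module.Free.chooseBasis F B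
  have hli : LinearIndependent L (μ ∘ b) := linearIndependent_of_fixed σ hσ s (fun i => hs _)
    (b.linearIndependent.map' μ (LinearMap.ker_eq_bot.mpr hμ))
  have h : μ.liftBaseChange L ∘ b.baseChange L = μ ∘ b := by
    ext i
    simp
  rw [← LinearMap.ker_eq_bot]
  rw [← h] at hli
  rw [LinearMap.ker_eq_bot']
  intro x hx
  have hx' := (b.baseChange L).linearCombination_repr x
  rw [← hx', LinearMap.map_finsupp_linearCombination] at hx
  rw [← hx', linearIndependent_iff.mp hli _ hx, map_zero]

end Descent

/-! ### Functions vanishing on the points over an algebraically closed field -/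

section Points

variable {Ω : Type*} [Field Ω] [IsAlgClosed Ω]

/-- The Nullstellensatz for a finitely generated algebra. -/
theorem isNilpotent_of_forall_algHom_eq_zero {C : Type*} [CommRing C] [Algebra Ω C]
    [Algebra.FiniteType Ω C] (c : C) (h : ∀ ψ : C →ₐ[Ω] Ω, ψ c = 0) : IsNilpotent c := by
  have : IsJacobsonRing C := isJacobsonRing_of_finiteType (A := Ω)
  rw [← mem_nilradical, nilradical, Ideal.radical_eq_jacobson, Ideal.jacobson, Ideal.mem_sInf]
  rintro m ⟨-, hm⟩
  let : Field (C ⧸ m) := Ideal.Quotient.field m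
  have : Module.Finite Ω (C ⧸ m) := finite_of_finite_type_of_isJacobsonRing Ω (C ⧸ m)
  let φ : (C ⧸ m) →ₐ[Ω] Ω := IsAlgClosed.lift
  have h1 : φ (Ideal.Quotient.mk m c) = 0 := h (φ.comp (Ideal.Quotient.mkₐ Ω m))
  rw [map_eq_zero_iff φ φ.toRingHom.injective] at h1
  exact Ideal.Quotient.eq_zero_iff_mem.mp h1

/-- Evaluation of functions on the base change to `M` of the affine `F`-scheme `Spec B` at one of its
points with values in a subfield of `M`. -/
def pointEval {F Ω M B : Type*} [CommRing F] [CommRing Ω] [Algebra F Ω] [CommRing M]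
    [Algebra Ω M] [Algebra F M] [IsScalarTower F Ω M] [CommRing B] [Algebra F B]
    (φ : B →ₐ[F] Ω) : M ⊗[F] B →ₐ[M] M :=
  Algebra.TensorProduct.lift (AlgHom.id M M) ((IsScalarTower.toAlgHom F Ω M).comp φ)
    (fun _ _ => Commute.all _ _)

/-- A function on the base change to `M` of an affine variety over `F` that vanishes at every
point over an algebraically closed subfield `Ω` of `M` is nilpotent: by the Nullstellensatz, its
coordinates in an `Ω`-basis of `M` are. -/
theorem isNilpotent_of_forall_point_eq_zero {F M B : Type*} [Field F] [Algebra F Ω] [Field M]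
    [Algebra Ω M] [Algebra F M] [IsScalarTower F Ω M] [CommRing B] [Algebra F B]
    [Algebra.FiniteType F B] (g : M ⊗[F] B)
    (h : ∀ φ : B →ₐ[F] Ω, pointEval (M := M) φ g = 0) : IsNilpotent g := by
  let e := Algebra.TensorProduct.cancelBaseChange F Ω Ω M B
  let b := Module.Free.chooseBasis Ω M
  obtain ⟨c, hc⟩ := TensorProduct.eq_repr_basis_left b (e.symm g)
  suffices hnil : ∀ i, IsNilpotent (c i) by
    have : IsNilpotent (e.symm g) := by
      rw [← hc, Finsupp.sum]
      refine isNilpotent_sum fun i _ => ?_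
      obtain ⟨n, hn⟩ := hnil i
      exact ⟨n, by rw [Algebra.TensorProduct.tmul_pow, hn, TensorProduct.tmul_zero]⟩
    simpa using this.map e
  intro i
  refine isNilpotent_of_forall_algHom_eq_zero (Ω := Ω) (c i) fun ψ => ?_
  have key : ∀ z : M ⊗[Ω] (Ω ⊗[F] B), pointEval (M := M)
      ((ψ.restrictScalars F).comp Algebra.TensorProduct.includeRight) (e z) =
      Algebra.TensorProduct.productMap (AlgHom.id Ω M)
        ((IsScalarTower.toAlgHom Ω Ω M).comp ψ) z := by
    intro z
    induction z using TensorProduct.induction_on with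
    | zero => simp
    | add u v hu hv => rw [map_add, map_add, map_add, hu, hv]
    | tmul m x =>
      induction x using TensorProduct.induction_on with
      | zero => simp
      | add u v hu hv => rw [TensorProduct.tmul_add, map_add, map_add, map_add, hu, hv]
      | tmul w x =>
        have : ψ (w ⊗ₜ x) = w * ψ (1 ⊗ₜ x) := by
          rw [← smul_eq_mul, ← map_smul, TensorProduct.smul_tmul', smul_eq_mul, mul_one]
        simp [e, pointEval, this, Algebra.smul_def]
        ring
  have h0 := h ((ψ.restrictScalars F).comp Algebra.TensorProduct.includeRight)
  rw [← e.apply_symm_apply g, key, ← hc, Finsupp.sum, map_sum] at h0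
  have h1 : Finsupp.linearCombination Ω b (c.mapRange ψ (map_zero ψ)) = 0 := by
    rw [Finsupp.linearCombination_apply, Finsupp.sum_mapRange_index (by simp), Finsupp.sum, ← h0]
    refine Finset.sum_congr rfl fun i _ => ?_
    simp [Algebra.smul_def, mul_comm]
  simpa using DFunLike.congr_fun (linearIndependent_iff.mp b.linearIndependent _ h1) i

end Points

/-! ### Nilpotent differences in `M ⊗ M` -/

section Transcendental

variable {E M : Type*} [Field E] [Field M] [Algebra E M]

/-- If `f` is transcendental over `E`, then `M ⊗[E] M` contains `M ⊗[E] E[f]`, a polynomial ring in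
one variable over `M`, where `1 ⊗ f - f ⊗ 1` is not nilpotent. -/
theorem isAlgebraic_of_isNilpotent_tmul_sub {f : M}
    (h : IsNilpotent ((1 : M) ⊗ₜ[E] f - f ⊗ₜ[E] (1 : M))) : IsAlgebraic E f := by
  by_contra htr
  have hinj : Function.Injective (Algebra.TensorProduct.map (AlgHom.id E M)
      (Polynomial.aeval (R := E) f)) :=
    Module.Flat.lTensor_preserves_injective_linearMap (M := M)
      (Polynomial.aeval (R := E) f).toLinearMap (transcendental_iff_injective.mp htr)
  let e := polyEquivTensor E M
  have h1 : Algebra.TensorProduct.map (AlgHom.id E M) (Polynomial.aeval (R := E) f)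
      (e (Polynomial.X - Polynomial.C f)) = (1 : M) ⊗ₜ[E] f - f ⊗ₜ[E] (1 : M) := by
    have hX : e Polynomial.X = 1 ⊗ₜ Polynomial.X := by
      rw [← e.eq_symm_apply]; simp [e]
    have hC : e (Polynomial.C f) = f ⊗ₜ 1 := by
      rw [← e.eq_symm_apply]; simp [e, Polynomial.smul_eq_C_mul]
    rw [map_sub, hX, hC]
    simp
  obtain ⟨n, hn⟩ := h
  rw [← h1, ← map_pow, ← map_pow, map_eq_zero_iff _ hinj, map_eq_zero_iff _ e.injective] at hn
  exact Polynomial.X_sub_C_ne_zero f (eq_zero_of_pow_eq_zero hn)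

theorem isAlgebraic_div_of_isNilpotent {a b : M} (hb : b ≠ 0)
    (h : IsNilpotent (b ⊗ₜ[E] a - a ⊗ₜ[E] b)) : IsAlgebraic E (a / b) := by
  apply isAlgebraic_of_isNilpotent_tmul_sub
  obtain ⟨n, hn⟩ := h
  refine ⟨n, ?_⟩
  have : (1 : M) ⊗ₜ[E] (a / b) - (a / b) ⊗ₜ[E] (1 : M) =
      (b⁻¹ ⊗ₜ b⁻¹) * (b ⊗ₜ[E] a - a ⊗ₜ[E] b) := by
    rw [mul_sub, Algebra.TensorProduct.tmul_mul_tmul, Algebra.TensorProduct.tmul_mul_tmul,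
      inv_mul_cancel₀ hb, div_eq_inv_mul]
  rw [this, mul_pow, hn, mul_zero]

end Transcendental

/-! ### Points of `GL_r` and the torsor -/

section GLTools

theorem map_map_GL {R S T : Type*} [CommRing R] [CommRing S] [CommRing T] {r : ℕ} (f : S →+* T)
    (g : R →+* S) (x : GL (Fin r) R) :
    Matrix.GeneralLinearGroup.map f (Matrix.GeneralLinearGroup.map g x) =
      Matrix.GeneralLinearGroup.map (f.comp g) x := rfl

theorem smul_eq_tmul_one_mul {R A B : Type*} [CommRing R] [CommRing A] [CommRing B] [Algebra R A]
    [Algebra R B] (a : A) (x : A ⊗[R] B) : a • x = (a ⊗ₜ 1) * x := by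
  induction x using TensorProduct.induction_on with
  | zero => simp
  | tmul b c => simp [TensorProduct.smul_tmul']
  | add x y hx hy => rw [smul_add, mul_add, hx, hy]

theorem map_evalGL {R S S' : Type*} [CommRing R] [CommRing S] [CommRing S'] [Algebra R S]
    [Algebra R S'] {r : ℕ} (φ : S →ₐ[R] S') (g : GL (Fin r) S) (h : GLRing R r) :
    φ (evalGL R g h) = evalGL R (Matrix.GeneralLinearGroup.map (φ : S →+* S') g) h := by
  have : φ.comp (evalGL R g) = evalGL R (Matrix.GeneralLinearGroup.map (φ : S →+* S') g) := by
    refine IsLocalization.algHom_ext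
      (Submonoid.powers (Matrix.mvPolynomialX (Fin r) (Fin r) R).det) ?_
    refine MvPolynomial.algHom_ext fun ⟨i, j⟩ => ?_
    exact (congrArg φ (evalGL_X g i j)).trans
      (evalGL_X (Matrix.GeneralLinearGroup.map (φ : S →+* S') g) i j).symm
  exact DFunLike.congr_fun this h

/-- The universal point of `GL_r`, with coordinates in the coordinate ring of `GL_r`. -/
def universalGL (R : Type*) [CommRing R] (r : ℕ) : GL (Fin r) (GLRing R r) :=
  Matrix.GeneralLinearGroup.mk'' (Matrix.of fun i j =>
    algebraMap (MvPolynomial (Fin r × Fin r) R) (GLRing R r) (MvPolynomial.X (i, j))) (by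
      have h := IsLocalization.Away.algebraMap_isUnit (S := GLRing R r)
        (Matrix.mvPolynomialX (Fin r) (Fin r) R).det
      rw [RingHom.map_det] at h
      exact h)

theorem map_universalGL {R S : Type*} [CommRing R] [CommRing S] [Algebra R S] {r : ℕ}
    (g : GL (Fin r) S) : Matrix.GeneralLinearGroup.map (evalGL R g : GLRing R r →+* S)
      (universalGL R r) = g := by
  ext i j
  exact evalGL_X g i j

theorem evalGL_map_universalGL {R S : Type*} [CommRing R] [CommRing S] [Algebra R S] {r : ℕ}
    (φ : GLRing R r →ₐ[R] S) :
    evalGL R (Matrix.GeneralLinearGroup.map (φ : GLRing R r →+* S) (universalGL R r)) = φ := by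
  have h : evalGL R (universalGL R r) = AlgHom.id R _ := by
    refine IsLocalization.algHom_ext
      (Submonoid.powers (Matrix.mvPolynomialX (Fin r) (Fin r) R).det) ?_
    refine MvPolynomial.algHom_ext fun ⟨i, j⟩ => ?_
    exact evalGL_X _ i j
  refine AlgHom.ext fun x => ?_
  rw [← map_evalGL, h]
  rfl

instance finiteType_GLRing (R : Type*) [CommRing R] (r : ℕ) :
    Algebra.FiniteType R (GLRing R r) :=
  have : Algebra.FiniteType (MvPolynomial (Fin r × Fin r) R) (GLRing R r) :=
    IsLocalization.finiteType_of_monoid_fg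
      (Submonoid.powers (Matrix.mvPolynomialX (Fin r) (Fin r) R).det) _
  Algebra.FiniteType.trans (S := MvPolynomial (Fin r × Fin r) R) inferInstance inferInstance

/-- A pair of ring homomorphisms that agree on `K` extends to `A ⊗[K] B`. -/
theorem exists_ringHom_tensorProduct {K A B C : Type*} [CommRing K] [CommRing A] [CommRing B]
    [Algebra K A] [Algebra K B] [CommRing C] (f : A →+* C) (g : B →+* C)
    (h : ∀ k : K, f (algebraMap K A k) = g (algebraMap K B k)) :
    ∃ τ : A ⊗[K] B →+* C, (∀ a, τ (a ⊗ₜ 1) = f a) ∧ ∀ b, τ (1 ⊗ₜ b) = g b := by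
  let := (f.comp (algebraMap K A)).toAlgebra
  refine ⟨(Algebra.TensorProduct.productMap (R := K) (S := C) ⟨f, fun _ => rfl⟩
    ⟨g, fun k => (h k).symm⟩ : A ⊗[K] B →ₐ[K] C), fun a => ?_, fun b => ?_⟩
  · exact (Algebra.TensorProduct.productMap_apply_tmul _ _ _ _).trans (by simp)
  · exact (Algebra.TensorProduct.productMap_apply_tmul _ _ _ _).trans (by simp)

end GLTools

section TensorMul

variable {F A B : Type*} [CommRing F] [CommRing A] [Algebra F A] [CommRing B] [Algebra F B] {r : ℕ}

variable (F) in
/-- The product in `GL_r` over `A ⊗[F] B` of a point over `A` and a point over `B`. -/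
def tensorMul (g : GL (Fin r) A) (u : GL (Fin r) B) : GL (Fin r) (A ⊗[F] B) :=
  Matrix.GeneralLinearGroup.map (algebraMap A (A ⊗[F] B)) g *
    Matrix.GeneralLinearGroup.map
      ((Algebra.TensorProduct.includeRight : B →ₐ[F] A ⊗[F] B) : B →+* A ⊗[F] B) u

theorem map_tensorMul {C : Type*} [CommRing C] (g : GL (Fin r) A) (u : GL (Fin r) B)
    (f : A ⊗[F] B →+* C) (f₁ : A →+* C) (f₂ : B →+* C) (h₁ : ∀ a, f (a ⊗ₜ 1) = f₁ a)
    (h₂ : ∀ b, f (1 ⊗ₜ b) = f₂ b) :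
    Matrix.GeneralLinearGroup.map f (tensorMul F g u) =
      Matrix.GeneralLinearGroup.map f₁ g * Matrix.GeneralLinearGroup.map f₂ u := by
  rw [tensorMul, map_mul, map_map_GL, map_map_GL,
    show f.comp (algebraMap A (A ⊗[F] B)) = f₁ from RingHom.ext h₁]
  have h : f.comp ((Algebra.TensorProduct.includeRight : B →ₐ[F] A ⊗[F] B) : B →+* A ⊗[F] B) = f₂ :=
    RingHom.ext fun b => h₂ b
  rw [h]

end TensorMul

section Torsor

variable {L : Type*} [Field L] {F K : Subfield L} {r : ℕ} {Ψ : GL (Fin r) L}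

variable (F K Ψ) in
/-- The coordinate ring of `Γ`. -/
def galoisRing : Type _ := GLRing F r ⧸ galoisIdeal F K Ψ

instance : CommRing (galoisRing F K Ψ) :=
  inferInstanceAs (CommRing (GLRing F r ⧸ galoisIdeal F K Ψ))

instance : Algebra F (galoisRing F K Ψ) :=
  inferInstanceAs (Algebra F (GLRing F r ⧸ galoisIdeal F K Ψ))

instance : Algebra.FiniteType F (galoisRing F K Ψ) :=
  inferInstanceAs (Algebra.FiniteType F (GLRing F r ⧸ galoisIdeal F K Ψ))

variable (F K Ψ) in
/-- The restriction of functions from `GL_r` to `Γ`. -/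
def toGaloisRing : GLRing F r →ₐ[F] galoisRing F K Ψ :=
  Ideal.Quotient.mkₐ F (galoisIdeal F K Ψ)

theorem toGaloisRing_surjective : Function.Surjective (toGaloisRing F K Ψ) :=
  Ideal.Quotient.mk_surjective

theorem toGaloisRing_eq_zero {h : GLRing F r} (hh : h ∈ galoisIdeal F K Ψ) :
    toGaloisRing F K Ψ h = 0 :=
  Ideal.Quotient.eq_zero_iff_mem.mpr hh

variable (F K Ψ) in
/-- The universal point of `Γ`. -/
def universalPoint : GL (Fin r) (galoisRing F K Ψ) :=
  Matrix.GeneralLinearGroup.map (toGaloisRing F K Ψ : GLRing F r →+* galoisRing F K Ψ)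
    (universalGL F r)

theorem evalGL_universalPoint (h : GLRing F r) :
    evalGL F (universalPoint F K Ψ) h = toGaloisRing F K Ψ h := by
  rw [universalPoint, evalGL_map_universalGL]

variable (F K Ψ) in
/-- The embedding of the coordinate ring of `Γ` into `L ⊗[K] L`, which maps the universal point to
`Ψ₁⁻¹ Ψ₂`. -/
def galoisRingHom : galoisRing F K Ψ →ₐ[F] L ⊗[K] L :=
  Ideal.kerLiftAlg (evalGL F (psiTwist K Ψ))

theorem galoisRingHom_injective : Function.Injective (galoisRingHom F K Ψ) :=
  Ideal.kerLiftAlg_injective _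

theorem map_galoisRingHom : Matrix.GeneralLinearGroup.map
    (galoisRingHom F K Ψ : galoisRing F K Ψ →+* L ⊗[K] L) (universalPoint F K Ψ) =
      psiTwist K Ψ := by
  rw [← map_universalGL (R := F) (psiTwist K Ψ)]
  rfl

/-- The points of `Γ` with values in `S` are the specializations of the universal point. -/
theorem mem_galoisPoints_iff {S : Type*} [CommRing S] [Algebra F S] {γ : GL (Fin r) S} :
    γ ∈ galoisPoints F K Ψ S ↔ ∃ φ : galoisRing F K Ψ →ₐ[F] S,
      Matrix.GeneralLinearGroup.map (φ : galoisRing F K Ψ →+* S) (universalPoint F K Ψ) = γ := by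
  constructor
  · intro hγ
    refine ⟨Ideal.Quotient.liftₐ (galoisIdeal F K Ψ) (evalGL F γ) hγ, ?_⟩
    conv_rhs => rw [← map_universalGL (R := F) γ]
    rfl
  · rintro ⟨φ, rfl⟩ h hh
    rw [← map_evalGL, evalGL_universalPoint, toGaloisRing_eq_zero hh, map_zero]

variable {σ : L ≃+* L} {Φ : GL (Fin r) K}

/-- The map `σ ⊗ σ` of `L ⊗[K] L` fixes `Ψ₁⁻¹ Ψ₂`: the factors `Φ` that it introduces in `Ψ₁` and `Ψ₂`
cancel, being defined over `K`. -/
theorem exists_semilinear_fixing_galoisRing (hadm : IsAdmissible σ F K)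
    (hΨ : IsFundamental K Ψ σ Φ) :
    ∃ s : L ⊗[K] L →ₛₗ[(σ : L →+* L)] L ⊗[K] L,
      ∀ b, s (galoisRingHom F K Ψ b) = galoisRingHom F K Ψ b := by
  have hF : ∀ c : F, σ c = c := fun c => by
    have : (c : L) ∈ fixedSubfield σ := by rw [hadm.fixed_E]; exact c.2
    exact this
  have hKσ : ∀ k : K, σ k ∈ K := fun k => by
    have : σ k ∈ K.map (σ : L →+* L) := ⟨k, k.2, rfl⟩
    rwa [hadm.map_K] at this
  have hlr : ∀ k : K, (k : L) ⊗ₜ[K] (1 : L) = 1 ⊗ₜ[K] (k : L) := fun k => by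
    have := TensorProduct.smul_tmul (R := K) k (1 : L) (1 : L)
    simpa only [Algebra.smul_def, mul_one] using! this
  let iL : L →+* L ⊗[K] L := (Algebra.TensorProduct.includeLeft : L →ₐ[K] L ⊗[K] L).toRingHom
  let iR : L →+* L ⊗[K] L := (Algebra.TensorProduct.includeRight : L →ₐ[K] L ⊗[K] L).toRingHom
  obtain ⟨τ, hτ1, hτ2⟩ := exists_ringHom_tensorProduct (K := K) (iL.comp (σ : L →+* L))
    (iR.comp (σ : L →+* L)) fun k => hlr ⟨σ k, hKσ k⟩
  have hτF : ∀ c : F, τ (algebraMap F (L ⊗[K] L) c) = algebraMap F (L ⊗[K] L) c := fun c => by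
    have h : algebraMap F (L ⊗[K] L) c = (c : L) ⊗ₜ 1 := rfl
    rw [h, hτ1]
    simp [iL, hF]
  let τF : L ⊗[K] L →ₐ[F] L ⊗[K] L := ⟨τ, hτF⟩
  have hτΨ : Matrix.GeneralLinearGroup.map τ (psiTwist K Ψ) = psiTwist K Ψ := by
    have h1 : τ.comp iL = iL.comp (σ : L →+* L) := RingHom.ext hτ1
    have h2 : τ.comp iR = iR.comp (σ : L →+* L) := RingHom.ext hτ2
    have h3 : iL.comp K.subtype = iR.comp K.subtype := RingHom.ext hlr
    show Matrix.GeneralLinearGroup.map τ ((Matrix.GeneralLinearGroup.map iL Ψ)⁻¹ *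
      Matrix.GeneralLinearGroup.map iR Ψ) = (Matrix.GeneralLinearGroup.map iL Ψ)⁻¹ *
      Matrix.GeneralLinearGroup.map iR Ψ
    rw [map_mul, map_inv, map_map_GL, map_map_GL, h1, h2, ← map_map_GL, ← map_map_GL,
      show Matrix.GeneralLinearGroup.map (σ : L →+* L) Ψ = _ from hΨ, map_mul, map_mul,
      map_map_GL, map_map_GL, h3]
    group
  refine ⟨{ toFun := τ, map_add' := map_add τ, map_smul' := fun l x => ?_ }, fun b => ?_⟩
  · rw [smul_eq_tmul_one_mul, map_mul, hτ1, smul_eq_tmul_one_mul]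
    rfl
  · obtain ⟨h, rfl⟩ := toGaloisRing_surjective b
    show τF (evalGL F (psiTwist K Ψ) h) = evalGL F (psiTwist K Ψ) h
    rw [map_evalGL]
    exact congrArg (fun g => evalGL F g h) hτΨ

/-- The map `L ⊗[F] F[Γ] → L ⊗[K] L` is injective; geometrically, `Z_L` is the `Γ_L`-torsor
`Ψ Γ_L`. -/
theorem galoisRing_lift_injective (hadm : IsAdmissible σ F K) (hΨ : IsFundamental K Ψ σ Φ) :
    Function.Injective (Algebra.TensorProduct.lift
      (Algebra.TensorProduct.includeLeft : L →ₐ[L] L ⊗[K] L) (galoisRingHom F K Ψ)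
      (fun _ _ => Commute.all _ _)) := by
  obtain ⟨s, hs⟩ := exists_semilinear_fixing_galoisRing hadm hΨ
  have h := liftBaseChange_injective_of_fixed (F := F) (σ : L →+* L) (fun x hx => by
    have : x ∈ fixedSubfield σ := hx
    rw [hadm.fixed_E] at this
    exact ⟨⟨x, this⟩, rfl⟩) s (galoisRingHom F K Ψ).toLinearMap galoisRingHom_injective hs
  convert h using 1
  ext x
  induction x using TensorProduct.induction_on with
  | zero => simp
  | tmul a b => simp [smul_eq_tmul_one_mul]
  | add x y hx hy => rw [map_add, map_add, hx, hy]

/-- Every equation of `Z` holds at `Ψ γ` for the universal point `γ` of `Γ`, because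
`L ⊗[F] F[Γ] → L ⊗[K] L` maps `Ψ γ` to `Ψ₂`. -/
theorem evalGL_tensorMul_universalPoint_eq_zero (hadm : IsAdmissible σ F K)
    (hΨ : IsFundamental K Ψ σ Φ) (h : GLRing K r) (hh : evalGL K Ψ h = 0) :
    evalGL K (tensorMul F Ψ (universalPoint F K Ψ)) h = 0 := by
  apply galoisRing_lift_injective hadm hΨ
  let θ := (Algebra.TensorProduct.lift
      (Algebra.TensorProduct.includeLeft : L →ₐ[L] L ⊗[K] L) (galoisRingHom F K Ψ)
      (fun _ _ => Commute.all _ _)).restrictScalars K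
  show θ _ = θ 0
  rw [map_evalGL, map_zero, map_tensorMul Ψ (universalPoint F K Ψ)
    (θ : L ⊗[F] galoisRing F K Ψ →+* L ⊗[K] L)
    (Algebra.TensorProduct.includeLeft : L →ₐ[K] L ⊗[K] L).toRingHom
    (galoisRingHom F K Ψ : galoisRing F K Ψ →+* L ⊗[K] L) (fun a => by simp [θ])
    (fun b => by simp [θ, ← Algebra.TensorProduct.one_def]), map_galoisRingHom, psiTwist,
    mul_inv_cancel_left]
  have := map_evalGL (Algebra.TensorProduct.includeRight : L →ₐ[K] L ⊗[K] L) Ψ h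
  rw [hh, map_zero] at this
  exact this.symm

end Torsor

/-! ### Algebras generated by a point of `GL_r` -/

section Generated

theorem injective_of_surjective_of_isNoetherianRing {R : Type*} [CommRing R] [IsNoetherianRing R]
    (f : R →+* R) (hf : Function.Surjective f) : Function.Injective f := by
  have hmono : Monotone fun n : ℕ => RingHom.ker (f ^ n) := by
    refine monotone_nat_of_le_succ fun n x hx => ?_
    rw [RingHom.mem_ker] at hx ⊢
    rw [pow_succ', RingHom.mul_def, RingHom.comp_apply, hx, map_zero]
  obtain ⟨n, hn⟩ := monotone_stabilizes_iff_noetherian.mpr ‹IsNoetherianRing R› ⟨_, hmono⟩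
  rw [injective_iff_map_eq_zero]
  intro x hx
  have hsurj : Function.Surjective (f ^ n) := by
    rw [RingHom.coe_pow]
    exact hf.iterate n
  obtain ⟨y, rfl⟩ := hsurj x
  have hy : y ∈ RingHom.ker (f ^ (n + 1)) := by
    rw [RingHom.mem_ker, pow_succ', RingHom.mul_def, RingHom.comp_apply, hx]
  have h := hn (n + 1) n.le_succ
  change RingHom.ker (f ^ n) = RingHom.ker (f ^ (n + 1)) at h
  rw [← h] at hy
  exact hy

variable {K E A R S : Type*} [Field K] [Field E] [Algebra K E] [CommRing A] [Algebra K A]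
  [CommRing R] [Algebra K R] [Algebra E R] [IsScalarTower K E R] [CommRing S] [Algebra K S] [Algebra E S]
  [IsScalarTower K E S] {r : ℕ}

/-- The point of `GL_r` over `R` obtained from a point `p` over `A` by a map `E ⊗[K] A → R`; the point
`p` is encoded as a homomorphism from the coordinate ring of `GL_r`. -/
def pointOfBaseChange (p : GLRing K r →ₐ[K] A) (t : E ⊗[K] A →ₐ[E] R) : GL (Fin r) R :=
  Matrix.GeneralLinearGroup.map (((t.restrictScalars K).comp
    (Algebra.TensorProduct.includeRight.comp p) : GLRing K r →ₐ[K] R) : GLRing K r →+* R)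
    (universalGL K r)

theorem evalGL_pointOfBaseChange (p : GLRing K r →ₐ[K] A) (t : E ⊗[K] A →ₐ[E] R)
    (h : GLRing K r) : evalGL K (pointOfBaseChange p t) h = t (1 ⊗ₜ p h) := by
  rw [pointOfBaseChange, evalGL_map_universalGL]
  rfl

/-- `R` is generated over `E` by the entries of the point and the inverse of its determinant. -/
theorem mem_span_evalGL_pointOfBaseChange (p : GLRing K r →ₐ[K] A) (t : E ⊗[K] A →ₐ[E] R)
    (hp : Function.Surjective p) (ht : Function.Surjective t) (x : R) :
    x ∈ Submodule.span E (Set.range (evalGL K (pointOfBaseChange p t))) := by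
  obtain ⟨z, rfl⟩ := ht x
  induction z using TensorProduct.induction_on with
  | zero => rw [map_zero]; exact zero_mem _
  | add x y hx hy => rw [map_add]; exact add_mem hx hy
  | tmul c y =>
    obtain ⟨h, rfl⟩ := hp y
    have : t (c ⊗ₜ p h) = c • evalGL K (pointOfBaseChange p t) h := by
      rw [evalGL_pointOfBaseChange, ← map_smul, TensorProduct.smul_tmul', smul_eq_mul, mul_one]
    rw [this]
    exact Submodule.smul_mem _ _ (Submodule.subset_span ⟨h, rfl⟩)

/-- If `R` is the base change of `A`, a point of `GL_r` over `S` that satisfies the equations over `K`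
defining `A` is the image of the point over `R` under a homomorphism. -/
theorem exists_algHom_map_pointOfBaseChange (p : GLRing K r →ₐ[K] A) (t : E ⊗[K] A →ₐ[E] R)
    (hp : Function.Surjective p) (ht : Function.Bijective t) (G : GL (Fin r) S)
    (hG : ∀ h, p h = 0 → evalGL K G h = 0) :
    ∃ θ : R →ₐ[E] S,
      Matrix.GeneralLinearGroup.map (θ : R →+* S) (pointOfBaseChange p t) = G := by
  let e := Ideal.quotientKerAlgEquivOfSurjective hp
  let θ₀ : A →ₐ[K] S := (Ideal.Quotient.liftₐ (RingHom.ker p) (evalGL K G) hG).comp e.symm.toAlgHom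
  have hθ₀ : ∀ h, θ₀ (p h) = evalGL K G h := fun h => by
    have : e.symm (p h) = Ideal.Quotient.mk _ h := by
      rw [e.symm_apply_eq]; rfl
    show Ideal.Quotient.liftₐ (RingHom.ker p) (evalGL K G) hG (e.symm (p h)) = _
    rw [this]
    rfl
  let t' : E ⊗[K] A ≃ₐ[E] R := AlgEquiv.ofBijective t ht
  let θ₁ : E ⊗[K] A →ₐ[E] S :=
    Algebra.TensorProduct.lift (Algebra.ofId E S) θ₀ (fun _ _ => Commute.all _ _)
  refine ⟨θ₁.comp t'.symm.toAlgHom, ?_⟩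
  have hθ : ∀ h, θ₁ (t'.symm (t (1 ⊗ₜ p h))) = evalGL K G h := fun h => by
    rw [show t (1 ⊗ₜ p h) = t' (1 ⊗ₜ p h) from rfl, t'.symm_apply_apply]
    simp [θ₁, hθ₀]
  conv_rhs => rw [← map_universalGL (R := K) G]
  rw [pointOfBaseChange, map_map_GL]
  congr 1
  exact congrArg _ (RingHom.ext hθ)

variable {P : GL (Fin r) R}

theorem algHom_ext_of_span (hP : ∀ x, x ∈ Submodule.span E (Set.range (evalGL K P)))
    {θ θ' : R →ₐ[E] S} (h : Matrix.GeneralLinearGroup.map (θ : R →+* S) P =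
      Matrix.GeneralLinearGroup.map (θ' : R →+* S) P) : θ = θ' := by
  refine AlgHom.ext fun x => ?_
  have hx := hP x
  induction hx using Submodule.span_induction with
  | mem x hx =>
    obtain ⟨g, rfl⟩ := hx
    have h1 := map_evalGL (θ.restrictScalars K) P g
    have h2 := map_evalGL (θ'.restrictScalars K) P g
    exact h1.trans ((congrArg (fun G => evalGL K G g) h).trans h2.symm)
  | zero => rw [map_zero, map_zero]
  | add x y _ _ hx hy => rw [map_add, map_add, hx, hy]
  | smul c x _ hx => rw [map_smul, map_smul, hx]

/-- The image under a homomorphism of the algebra generated by `P` lies in every subalgebra over which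
the image of `P` is an invertible matrix. -/
theorem mem_of_map_eq_map_val (hP : ∀ x, x ∈ Submodule.span E (Set.range (evalGL K P)))
    (θ : R →ₐ[E] S) (B : Subalgebra E S) (G : GL (Fin r) B)
    (h : Matrix.GeneralLinearGroup.map (θ : R →+* S) P =
      Matrix.GeneralLinearGroup.map (B.val : B →+* S) G) (x : R) : θ x ∈ B := by
  have hx := hP x
  induction hx using Submodule.span_induction with
  | mem x hx =>
    obtain ⟨g, rfl⟩ := hx
    have h1 := map_evalGL (θ.restrictScalars K) P g
    have h2 := map_evalGL (B.val.restrictScalars K) G g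
    have h3 := h1.trans ((congrArg (fun G => evalGL K G g) h).trans h2.symm)
    exact (show θ (evalGL K P g) = _ from h3) ▸ (evalGL K G g).2
  | zero => rw [map_zero]; exact zero_mem _
  | add x y _ _ hx hy => rw [map_add]; exact add_mem hx hy
  | smul c x _ hx => rw [map_smul]; exact B.smul_mem hx c

end Generated

/-! ### Translations and the fraction field -/

section Translation

variable {K E M : Type*} [Field K] [Field E] [Field M] [Algebra K E] [Algebra K M] [Algebra E M]
  [IsScalarTower K E M] {r : ℕ} {R : Subalgebra E M} {P : GL (Fin r) R}

theorem exists_div_of_mem_adjoin (f : IntermediateField.adjoin E (R : Set M)) :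
    ∃ a b : R, b ≠ 0 ∧ (f : M) = a / b := by
  obtain ⟨a, ha, b, hb, h⟩ := IntermediateField.mem_adjoin_iff_div.mp f.2
  rw [Algebra.adjoin_eq] at ha hb
  -- for `b = 0` the quotient `a / b` is `0`, which is also `0 / 1`
  by_cases hb0 : b = 0
  · exact ⟨0, 1, one_ne_zero, by simp [h, hb0]⟩
  · exact ⟨⟨a, ha⟩, ⟨b, hb⟩, fun h => hb0 (congrArg Subtype.val h), h⟩

/-- An automorphism of a subalgebra of a field extends to the fraction field. -/
theorem exists_algEquiv_adjoin (θ : R ≃ₐ[E] R) :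
    ∃ τ : IntermediateField.adjoin E (R : Set M) ≃ₐ[E] IntermediateField.adjoin E (R : Set M),
      ∀ x : R, ((τ ⟨x, IntermediateField.subset_adjoin E _ x.2⟩ :
        IntermediateField.adjoin E (R : Set M)) : M) = θ x := by
  let Q := IntermediateField.adjoin E (R : Set M)
  have hle : R ≤ Q.toSubalgebra := fun x hx => IntermediateField.subset_adjoin E _ hx
  let i : R →ₐ[E] Q := Subalgebra.inclusion hle
  let : Algebra R Q := i.toRingHom.toAlgebra
  have : IsScalarTower E R Q := IsScalarTower.of_algebraMap_eq fun _ => rfl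
  have : FaithfulSMul R Q :=
    (faithfulSMul_iff_algebraMap_injective R Q).mpr (Subalgebra.inclusion_injective hle)
  have : IsFractionRing R Q := IsFractionRing.of_field R Q fun z => by
    obtain ⟨a, b, -, h⟩ := exists_div_of_mem_adjoin z
    exact ⟨a, b, Subtype.ext h⟩
  exact ⟨IsFractionRing.algEquivOfAlgEquiv θ, fun x =>
    congrArg Subtype.val (IsFractionRing.algEquivOfAlgEquiv_algebraMap θ x)⟩

theorem algEquiv_adjoin_apply_div
    (τ : IntermediateField.adjoin E (R : Set M) ≃ₐ[E] IntermediateField.adjoin E (R : Set M))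
    (θ : R →ₐ[E] M) (hτ : ∀ x : R, ((τ ⟨x, IntermediateField.subset_adjoin E _ x.2⟩ :
        IntermediateField.adjoin E (R : Set M)) : M) = θ x)
    (f : IntermediateField.adjoin E (R : Set M)) (a b : R) (h : (f : M) = a / b) :
    (τ f : M) = θ a / θ b := by
  have : f = (⟨a, IntermediateField.subset_adjoin E _ a.2⟩ :
      IntermediateField.adjoin E (R : Set M)) / ⟨b, IntermediateField.subset_adjoin E _ b.2⟩ :=
    Subtype.ext h
  rw [this, map_div₀, ← hτ, ← hτ]
  rfl

/-- A translation `P ↦ P c` of the subalgebra `R` generated by `P` by a matrix `c` over the base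
field is an automorphism of `R`: it is surjective, hence injective because `R` is noetherian. -/
theorem exists_algEquiv_of_translation [IsNoetherianRing R]
    (hP : ∀ x, x ∈ Submodule.span E (Set.range (evalGL K P))) (θ : R →ₐ[E] M) (c : GL (Fin r) E)
    (hθ : Matrix.GeneralLinearGroup.map (θ : R →+* M) P =
      Matrix.GeneralLinearGroup.map (R.val : R →+* M) P *
        Matrix.GeneralLinearGroup.map (algebraMap E M) c) :
    ∃ e : R ≃ₐ[E] R, ∀ x, (e x : M) = θ x := by
  have hmem : ∀ x, θ x ∈ R := mem_of_map_eq_map_val hP θ R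
    (P * Matrix.GeneralLinearGroup.map (algebraMap E R) c) (by rw [hθ, map_mul]; rfl)
  have hmem' : ∀ x, R.val x ∈ θ.range := mem_of_map_eq_map_val hP R.val θ.range
    (Matrix.GeneralLinearGroup.map (θ.rangeRestrict : R →+* θ.range) P *
      Matrix.GeneralLinearGroup.map (algebraMap E θ.range) c⁻¹) (by
    rw [map_mul, map_map_GL, map_map_GL, map_inv]
    have h1 : Matrix.GeneralLinearGroup.map ((θ.range.val : θ.range →+* M).comp
        (θ.rangeRestrict : R →+* θ.range)) P =
        Matrix.GeneralLinearGroup.map (θ : R →+* M) P := rfl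
    have h2 : (θ.range.val : θ.range →+* M).comp (algebraMap E θ.range) = algebraMap E M := rfl
    rw [h1, h2, hθ, mul_inv_cancel_right])
  let θ' : R →ₐ[E] R := θ.codRestrict R hmem
  have hsurj : Function.Surjective θ' := fun y => by
    obtain ⟨x, hx⟩ := hmem' y
    exact ⟨x, Subtype.ext hx⟩
  exact ⟨AlgEquiv.ofBijective θ'
    ⟨injective_of_surjective_of_isNoetherianRing θ'.toRingHom hsurj, hsurj⟩, fun x => rfl⟩

end Translation

/-! ### Elements fixed by all translations -/

section Fixed

variable {F Ω K E M B : Type*} [Field F] [Field Ω] [IsAlgClosed Ω] [Field K] [Field E] [Field M]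
  [CommRing B] [Algebra F Ω] [Algebra Ω M] [Algebra F M] [IsScalarTower F Ω M] [Algebra K E]
  [Algebra K M] [Algebra E M] [IsScalarTower K E M] [Algebra F B] [Algebra.FiniteType F B] {r : ℕ}
  {R : Subalgebra E M} {P : GL (Fin r) R}

/-- If the translations of `a / b` by all `Ω`-points of `Spec B` agree with `a / b`, then so does the
translation by the universal point up to nilpotents, and at the point `P₁⁻¹ P₂` this says that
`b ⊗ a - a ⊗ b` is nilpotent. -/
theorem isAlgebraic_div_of_forall_translation_eq
    (hP : ∀ x, x ∈ Submodule.span E (Set.range (evalGL K P))) (u : GL (Fin r) B)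
    (ρ : R →ₐ[E] M ⊗[F] B)
    (hρ : Matrix.GeneralLinearGroup.map (ρ : R →+* M ⊗[F] B) P =
      tensorMul F (Matrix.GeneralLinearGroup.map (R.val : R →+* M) P) u)
    (j : B →ₐ[F] M ⊗[E] M)
    (hj : Matrix.GeneralLinearGroup.map (j : B →+* M ⊗[E] M) u =
      (Matrix.GeneralLinearGroup.map (algebraMap M (M ⊗[E] M))
        (Matrix.GeneralLinearGroup.map (R.val : R →+* M) P))⁻¹ *
      Matrix.GeneralLinearGroup.map
        ((Algebra.TensorProduct.includeRight : M →ₐ[E] M ⊗[E] M) : M →+* M ⊗[E] M)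
        (Matrix.GeneralLinearGroup.map (R.val : R →+* M) P))
    {a b : R} (hb : b ≠ 0)
    (hab : ∀ φ : B →ₐ[F] Ω, pointEval φ (ρ a) * (b : M) = a * pointEval φ (ρ b)) :
    IsAlgebraic E ((a : M) / b) := by
  let κ : M ⊗[F] B →ₐ[M] M ⊗[E] M := Algebra.TensorProduct.lift
    (Algebra.TensorProduct.includeLeft : M →ₐ[M] M ⊗[E] M) j (fun _ _ => Commute.all _ _)
  have hκρ : (κ.restrictScalars E).comp ρ =
      (Algebra.TensorProduct.includeRight : M →ₐ[E] M ⊗[E] M).comp R.val := by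
    refine algHom_ext_of_span hP ?_
    have h1 := map_tensorMul (Matrix.GeneralLinearGroup.map (R.val : R →+* M) P) u
      (κ : M ⊗[F] B →+* M ⊗[E] M) (algebraMap M (M ⊗[E] M)) (j : B →+* M ⊗[E] M)
      (fun m => by simp [κ]) (fun m => by simp [κ, ← Algebra.TensorProduct.one_def])
    rw [← hρ, hj, mul_inv_cancel_left] at h1
    exact h1
  have hκ : ∀ x : R, κ (ρ x) = 1 ⊗ₜ (x : M) := fun x => DFunLike.congr_fun hκρ x
  have hnil := isNilpotent_of_forall_point_eq_zero (Ω := Ω)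
    (ρ a * algebraMap M (M ⊗[F] B) b - algebraMap M (M ⊗[F] B) a * ρ b) fun φ => by
      rw [map_sub, map_mul, map_mul, AlgHom.commutes, AlgHom.commutes]
      exact sub_eq_zero.mpr (hab φ)
  have h := hnil.map κ
  rw [map_sub, map_mul, map_mul, AlgHom.commutes, AlgHom.commutes, hκ, hκ,
    Algebra.TensorProduct.algebraMap_apply, Algebra.TensorProduct.algebraMap_apply,
    Algebra.TensorProduct.tmul_mul_tmul, Algebra.TensorProduct.tmul_mul_tmul] at h
  simp only [one_mul, mul_one, Algebra.algebraMap_self, RingHom.id_apply] at h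
  exact isAlgebraic_div_of_isNilpotent (fun h => hb (Subtype.ext h)) h

end Fixed

/-! ### The action of `Γ` on `Z` over the algebraic closure of `K` -/

section Action

variable {L : Type*} [Field L] {F K : Subfield L} {r : ℕ} {Ψ : GL (Fin r) L}
  {M : Type*} [Field M] [Algebra L M]

theorem sigmaTildeMap_injective [Algebra.IsGeometricallyReduced K L]
    (hK : algebraicClosure K (lambdaField K Ψ) = ⊥) :
    Function.Injective (sigmaTildeMap K Ψ M) := by
  have : Algebra.IsGeometricallyReduced K (lambdaField K Ψ) :=
    Algebra.IsGeometricallyReduced.of_injective (lambdaField K Ψ).val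
      (lambdaField K Ψ).val.injective
  have h1 := lift_injective_of_isAlgebraic (M := M) (S := algebraicClosure K M) hK
  have hle : sigmaRing K Ψ ≤ (lambdaField K Ψ).toSubalgebra := fun x hx =>
    IntermediateField.subset_adjoin K _ hx
  let i : sigmaRing K Ψ →ₐ[K] lambdaField K Ψ := Subalgebra.inclusion hle
  have h2 : Function.Injective (Algebra.TensorProduct.map (AlgHom.id K (algebraicClosure K M)) i) :=
    Module.Flat.lTensor_preserves_injective_linearMap (M := algebraicClosure K M) i.toLinearMap
      (Subalgebra.inclusion_injective hle)
  have h3 : ∀ x, sigmaTildeMap K Ψ M x = Algebra.TensorProduct.productMap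
      (IsScalarTower.toAlgHom K (algebraicClosure K M) M)
      (IsScalarTower.toAlgHom K (lambdaField K Ψ) M)
      (Algebra.TensorProduct.map (AlgHom.id K (algebraicClosure K M)) i x) := fun x => by
    induction x using TensorProduct.induction_on with
    | zero => rw [map_zero, map_zero, map_zero]
    | tmul a b => rfl
    | add x y hx hy => rw [map_add, map_add, map_add, hx, hy]
  intro x y hxy
  rw [h3, h3] at hxy
  exact h2 (h1 hxy)

variable (K Ψ) in
/-- The surjection from `K[X, 1 / det X]` to the coordinate ring of `Z`. -/
def toSigmaRing : GLRing K r →ₐ[K] sigmaRing K Ψ := (evalGL K Ψ).rangeRestrict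

variable (K Ψ M) in
/-- The surjection from `K̄ ⊗[K] Σ` to the coordinate ring of `Z` over `K̄`. -/
def toSigmaTilde : (algebraicClosure K M) ⊗[K] (sigmaRing K Ψ) →ₐ[algebraicClosure K M]
    sigmaTilde K Ψ M := (sigmaTildeMap K Ψ M).rangeRestrict

instance : IsScalarTower K (algebraicClosure K M) (sigmaTilde K Ψ M) :=
  IsScalarTower.of_algebraMap_eq fun _ => rfl

variable (K Ψ M) in
/-- The matrix `Ψ` as a point of `GL_r` over the coordinate ring of `Z` over `K̄`. -/
def psiSigmaTilde : GL (Fin r) (sigmaTilde K Ψ M) :=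
  pointOfBaseChange (toSigmaRing K Ψ) (toSigmaTilde K Ψ M)

theorem mem_span_evalGL_psiSigmaTilde (x : sigmaTilde K Ψ M) :
    x ∈ Submodule.span (algebraicClosure K M) (Set.range (evalGL K (psiSigmaTilde K Ψ M))) :=
  mem_span_evalGL_pointOfBaseChange _ _ (evalGL K Ψ).rangeRestrict_surjective
    (sigmaTildeMap K Ψ M).rangeRestrict_surjective x

theorem map_val_psiSigmaTilde : Matrix.GeneralLinearGroup.map
    ((sigmaTilde K Ψ M).val : sigmaTilde K Ψ M →+* M) (psiSigmaTilde K Ψ M) =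
      Matrix.GeneralLinearGroup.map (algebraMap L M) Ψ := by
  ext i j
  rw [← evalGL_X (R := K) (Matrix.GeneralLinearGroup.map
    ((sigmaTilde K Ψ M).val : sigmaTilde K Ψ M →+* M) (psiSigmaTilde K Ψ M)) i j]
  have h := map_evalGL ((sigmaTilde K Ψ M).val.restrictScalars K) (psiSigmaTilde K Ψ M)
    (algebraMap (MvPolynomial (Fin r × Fin r) K) (GLRing K r) (MvPolynomial.X (i, j)))
  refine h.symm.trans ?_
  rw [psiSigmaTilde, evalGL_pointOfBaseChange]
  show (1 : M) * algebraMap L M (evalGL K Ψ _) = algebraMap L M (Ψ i j)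
  rw [evalGL_X, one_mul]

instance : IsNoetherianRing (sigmaTilde K Ψ M) := by
  have : Algebra.FiniteType K (sigmaRing K Ψ) :=
    Algebra.FiniteType.of_surjective (toSigmaRing K Ψ) (evalGL K Ψ).rangeRestrict_surjective
  have : Algebra.FiniteType (algebraicClosure K M) (sigmaTilde K Ψ M) :=
    Algebra.FiniteType.of_surjective (toSigmaTilde K Ψ M)
      (sigmaTildeMap K Ψ M).rangeRestrict_surjective
  exact Algebra.FiniteType.isNoetherianRing (algebraicClosure K M) _

variable {σ : L ≃+* L} {Φ : GL (Fin r) K}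

/-- The action of `Γ` on `Z` over `K̄`, in terms of coordinate rings: translation by the universal
point of `Γ`. -/
theorem exists_coaction (hadm : IsAdmissible σ F K) (hΨ : IsFundamental K Ψ σ Φ)
    (hinj : Function.Injective (sigmaTildeMap K Ψ M)) :
    ∃ ρ : sigmaTilde K Ψ M →ₐ[algebraicClosure K M] M ⊗[F] galoisRing F K Ψ,
      Matrix.GeneralLinearGroup.map (ρ : sigmaTilde K Ψ M →+* M ⊗[F] galoisRing F K Ψ)
        (psiSigmaTilde K Ψ M) =
      tensorMul F (Matrix.GeneralLinearGroup.map (algebraMap L M) Ψ) (universalPoint F K Ψ) := by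
  refine exists_algHom_map_pointOfBaseChange _ _ (evalGL K Ψ).rangeRestrict_surjective
    ⟨fun x y h => hinj (congrArg Subtype.val h),
      (sigmaTildeMap K Ψ M).rangeRestrict_surjective⟩ _ fun h hh => ?_
  have h0 := evalGL_tensorMul_universalPoint_eq_zero hadm hΨ h (congrArg Subtype.val hh)
  let f : L ⊗[F] galoisRing F K Ψ →ₐ[L] M ⊗[F] galoisRing F K Ψ :=
    Algebra.TensorProduct.map (Algebra.ofId L M) (AlgHom.id F (galoisRing F K Ψ))
  have h1 := map_evalGL (f.restrictScalars K) (tensorMul F Ψ (universalPoint F K Ψ)) h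
  rw [h0, map_zero] at h1
  rw [h1]
  have h2 := map_tensorMul Ψ (universalPoint F K Ψ) (f : L ⊗[F] galoisRing F K Ψ →+* _)
    ((algebraMap M (M ⊗[F] galoisRing F K Ψ)).comp (algebraMap L M))
    ((Algebra.TensorProduct.includeRight : galoisRing F K Ψ →ₐ[F] M ⊗[F] galoisRing F K Ψ) :
      galoisRing F K Ψ →+* M ⊗[F] galoisRing F K Ψ)
    (fun a => by simp [f, Algebra.ofId_apply]) (fun b => by simp [f])
  exact congrArg (fun G => evalGL K G h) h2.symm

/-- The composite of the embedding of the coordinate ring of `Γ` into `L ⊗[K] L` with the map to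
`M ⊗[K̄] M`. -/
theorem exists_algHom_galoisRing :
    ∃ j : galoisRing F K Ψ →ₐ[F] M ⊗[algebraicClosure K M] M,
      Matrix.GeneralLinearGroup.map (j : galoisRing F K Ψ →+* M ⊗[algebraicClosure K M] M)
          (universalPoint F K Ψ) =
        (Matrix.GeneralLinearGroup.map (algebraMap M (M ⊗[algebraicClosure K M] M))
          (Matrix.GeneralLinearGroup.map (algebraMap L M) Ψ))⁻¹ *
        Matrix.GeneralLinearGroup.map
          ((Algebra.TensorProduct.includeRight : M →ₐ[algebraicClosure K M]
            M ⊗[algebraicClosure K M] M) : M →+* M ⊗[algebraicClosure K M] M)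
          (Matrix.GeneralLinearGroup.map (algebraMap L M) Ψ) := by
  obtain ⟨τ, hτ1, hτ2⟩ := exists_ringHom_tensorProduct (K := K) (A := L) (B := L)
    ((algebraMap M (M ⊗[algebraicClosure K M] M)).comp (algebraMap L M))
    (((Algebra.TensorProduct.includeRight : M →ₐ[algebraicClosure K M]
      M ⊗[algebraicClosure K M] M) : M →+* M ⊗[algebraicClosure K M] M).comp (algebraMap L M))
    (fun k => by
      have h := (Algebra.TensorProduct.includeRight : M →ₐ[algebraicClosure K M]
        M ⊗[algebraicClosure K M] M).commutes (algebraMap K (algebraicClosure K M) k)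
      exact h.symm)
  let j : galoisRing F K Ψ →ₐ[F] M ⊗[algebraicClosure K M] M :=
    { τ.comp (galoisRingHom F K Ψ : galoisRing F K Ψ →+* L ⊗[K] L) with
      commutes' := fun c => by
        show τ (galoisRingHom F K Ψ (algebraMap F _ c)) = _
        rw [AlgHom.commutes]
        exact hτ1 c }
  refine ⟨j, ?_⟩
  have h1 : Matrix.GeneralLinearGroup.map (j : galoisRing F K Ψ →+* M ⊗[algebraicClosure K M] M)
      (universalPoint F K Ψ) = Matrix.GeneralLinearGroup.map τ (psiTwist K Ψ) := by
    rw [← map_galoisRingHom (F := F), map_map_GL]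
    rfl
  rw [h1, psiTwist, map_mul, map_inv, map_map_GL, map_map_GL, map_map_GL, map_map_GL]
  congr 2
  · congr 2
    exact RingHom.ext hτ1
  · congr 1
    exact RingHom.ext hτ2

theorem coe_psiSigmaTilde (i j : Fin r) :
    (psiSigmaTilde K Ψ M i j : M) = algebraMap L M (Ψ i j) :=
  congrArg (fun g : GL (Fin r) M => g i j) (map_val_psiSigmaTilde (K := K) (Ψ := Ψ) (M := M))

/-- The specialization of the coaction at a point of `Γ`. -/
theorem exists_translation
    {ρ : sigmaTilde K Ψ M →ₐ[algebraicClosure K M] M ⊗[F] galoisRing F K Ψ}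
    (hρ : Matrix.GeneralLinearGroup.map (ρ : sigmaTilde K Ψ M →+* M ⊗[F] galoisRing F K Ψ)
        (psiSigmaTilde K Ψ M) =
      tensorMul F (Matrix.GeneralLinearGroup.map (algebraMap L M) Ψ) (universalPoint F K Ψ))
    (φ : galoisRing F K Ψ →ₐ[F] algebraicClosure F M) :
    ∃ θ : sigmaTilde K Ψ M →ₐ[algebraicClosure K M] M,
      (∀ x, θ x = pointEval (M := M) φ (ρ x)) ∧
      Matrix.GeneralLinearGroup.map (θ : sigmaTilde K Ψ M →+* M) (psiSigmaTilde K Ψ M) =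
        Matrix.GeneralLinearGroup.map (algebraMap L M) Ψ *
          Matrix.GeneralLinearGroup.map (algebraMap (algebraicClosure F M) M)
            (Matrix.GeneralLinearGroup.map
              (φ : galoisRing F K Ψ →+* algebraicClosure F M) (universalPoint F K Ψ)) := by
  refine ⟨((pointEval (M := M) φ).restrictScalars (algebraicClosure K M)).comp ρ,
    fun _ => rfl, ?_⟩
  have h := map_tensorMul (Matrix.GeneralLinearGroup.map (algebraMap L M) Ψ)
    (universalPoint F K Ψ) (pointEval (M := M) φ : M ⊗[F] galoisRing F K Ψ →+* M) (RingHom.id M)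
    ((algebraMap (algebraicClosure F M) M).comp
      (φ : galoisRing F K Ψ →+* algebraicClosure F M))
    (fun a => by simp [pointEval]) (fun b => by simp [pointEval])
  rw [← hρ] at h
  exact h

theorem sigmaTilde_algHom_ext {θ θ' : sigmaTilde K Ψ M →ₐ[algebraicClosure K M] M}
    (h : Matrix.GeneralLinearGroup.map (θ : sigmaTilde K Ψ M →+* M) (psiSigmaTilde K Ψ M) =
      Matrix.GeneralLinearGroup.map (θ' : sigmaTilde K Ψ M →+* M) (psiSigmaTilde K Ψ M)) :
    θ = θ' := by
  have h1 := mem_span_evalGL_psiSigmaTilde (K := K) (Ψ := Ψ) (M := M)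
  have h2 := algHom_ext_of_span (E := algebraicClosure K M) h1 (S := M) (θ := θ) (θ' := θ')
  exact h2 h

/-- Over the coordinate ring of `Z`, the automorphism induced by `γ` is the homomorphism that maps
`Ψ` to `Ψ γ`. -/
theorem isInducedBy_iff {γ : GL (Fin r) (algebraicClosure F M)}
    {θ : sigmaTilde K Ψ M →ₐ[algebraicClosure K M] M}
    (hθ : Matrix.GeneralLinearGroup.map (θ : sigmaTilde K Ψ M →+* M) (psiSigmaTilde K Ψ M) =
      Matrix.GeneralLinearGroup.map (algebraMap L M) Ψ *
        Matrix.GeneralLinearGroup.map (algebraMap (algebraicClosure F M) M) γ)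
    {τ : lambdaTilde K Ψ M ≃ₐ[algebraicClosure K M] lambdaTilde K Ψ M} :
    IsInducedBy F K Ψ M γ τ ↔ ∀ x : sigmaTilde K Ψ M,
      ((τ ⟨x, IntermediateField.subset_adjoin _ _ x.2⟩ : lambdaTilde K Ψ M) : M) = θ x := by
  have hle : sigmaTilde K Ψ M ≤ (lambdaTilde K Ψ M).toSubalgebra := fun x hx =>
    IntermediateField.subset_adjoin _ _ hx
  let θτ : sigmaTilde K Ψ M →ₐ[algebraicClosure K M] M :=
    ((lambdaTilde K Ψ M).val.comp τ.toAlgHom).comp (Subalgebra.inclusion hle)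
  have hentry : ∀ i j, Matrix.GeneralLinearGroup.map (θτ : sigmaTilde K Ψ M →+* M)
      (psiSigmaTilde K Ψ M) i j = ((τ (psiTilde K Ψ M i j) : lambdaTilde K Ψ M) : M) :=
    fun i j => by
      have : Subalgebra.inclusion hle (psiSigmaTilde K Ψ M i j) = psiTilde K Ψ M i j :=
        Subtype.ext (coe_psiSigmaTilde i j)
      rw [← this]
      rfl
  constructor
  · intro h
    have h1 : θτ = θ := by
      refine sigmaTilde_algHom_ext (Eq.trans ?_ hθ.symm)
      ext i j
      rw [hentry]
      exact congrFun (congrFun h i) j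
    exact fun x => DFunLike.congr_fun h1 x
  · intro h
    have h1 : θτ = θ := AlgHom.ext h
    ext i j
    show ((τ (psiTilde K Ψ M i j) : lambdaTilde K Ψ M) : M) = _
    rw [← hentry, h1]
    exact congrArg (fun g : GL (Fin r) M => g i j) hθ

/-- Every point of `Γ` over `F̄` induces an automorphism, as `F̄ ⊆ K̄`. -/
theorem exists_isInducedBy (hadm : IsAdmissible σ F K) (hΨ : IsFundamental K Ψ σ Φ)
    (hinj : Function.Injective (sigmaTildeMap K Ψ M)) {γ : GL (Fin r) (algebraicClosure F M)}
    (hγ : γ ∈ galoisPoints F K Ψ (algebraicClosure F M)) :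
    ∃ τ, IsInducedBy F K Ψ M γ τ := by
  obtain ⟨ρ, hρ⟩ := exists_coaction hadm hΨ hinj
  obtain ⟨φ, rfl⟩ := mem_galoisPoints_iff.mp hγ
  have hmem : ∀ x : algebraicClosure F M, (x : M) ∈ algebraicClosure K M := fun x => by
    let : Algebra F K := (Subfield.inclusion hadm.le).toAlgebra
    have : IsScalarTower F K M := IsScalarTower.of_algebraMap_eq fun _ => rfl
    have hx : IsAlgebraic F (x : M) := mem_algebraicClosure_iff.mp x.2
    exact mem_algebraicClosure_iff.mpr (hx.tower_top K)
  let ι : algebraicClosure F M →+* algebraicClosure K M :=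
    (algebraMap (algebraicClosure F M) M).codRestrict (algebraicClosure K M) hmem
  obtain ⟨θ, -, hθ⟩ := exists_translation hρ φ
  have hP := mem_span_evalGL_psiSigmaTilde (K := K) (Ψ := Ψ) (M := M)
  obtain ⟨e, he⟩ := exists_algEquiv_of_translation (E := algebraicClosure K M) hP θ
    (Matrix.GeneralLinearGroup.map ι (Matrix.GeneralLinearGroup.map
      (φ : galoisRing F K Ψ →+* algebraicClosure F M) (universalPoint F K Ψ)))
    (by rw [hθ, map_val_psiSigmaTilde]; rfl)
  obtain ⟨τ, hτ⟩ := exists_algEquiv_adjoin e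
  exact ⟨τ, (isInducedBy_iff hθ).mpr fun x => (hτ x).trans (he x)⟩

theorem isInducedBy_unique (hadm : IsAdmissible σ F K) (hΨ : IsFundamental K Ψ σ Φ)
    (hinj : Function.Injective (sigmaTildeMap K Ψ M)) {γ : GL (Fin r) (algebraicClosure F M)}
    (hγ : γ ∈ galoisPoints F K Ψ (algebraicClosure F M))
    {τ τ' : lambdaTilde K Ψ M ≃ₐ[algebraicClosure K M] lambdaTilde K Ψ M}
    (h : IsInducedBy F K Ψ M γ τ) (h' : IsInducedBy F K Ψ M γ τ') : τ = τ' := by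
  obtain ⟨ρ, hρ⟩ := exists_coaction hadm hΨ hinj
  obtain ⟨φ, rfl⟩ := mem_galoisPoints_iff.mp hγ
  obtain ⟨θ, -, hθ⟩ := exists_translation hρ φ
  refine AlgEquiv.ext fun f => ?_
  obtain ⟨a, b, -, hf⟩ := exists_div_of_mem_adjoin f
  exact Subtype.ext ((algEquiv_adjoin_apply_div τ θ ((isInducedBy_iff hθ).mp h) f a b hf).trans
    (algEquiv_adjoin_apply_div τ' θ ((isInducedBy_iff hθ).mp h') f a b hf).symm)

/-- An element of `Λ̃` fixed by `Γ(F̄)` lies in `K̄`. -/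
theorem mem_range_of_forall_isInducedBy [IsAlgClosed M] (hadm : IsAdmissible σ F K)
    (hΨ : IsFundamental K Ψ σ Φ) (hinj : Function.Injective (sigmaTildeMap K Ψ M))
    (f : lambdaTilde K Ψ M)
    (hf : ∀ γ ∈ galoisPoints F K Ψ (algebraicClosure F M), ∃ τ, IsInducedBy F K Ψ M γ τ ∧ τ f = f) :
    f ∈ Set.range (algebraMap (algebraicClosure K M) (lambdaTilde K Ψ M)) := by
  obtain ⟨ρ, hρ⟩ := exists_coaction hadm hΨ hinj
  obtain ⟨j, hj⟩ := exists_algHom_galoisRing (F := F) (K := K) (Ψ := Ψ) (M := M)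
  obtain ⟨a, b, hb, hab⟩ := exists_div_of_mem_adjoin f
  have : IsAlgClosed (algebraicClosure F M) := IsAlgClosure.isAlgClosed F
  rw [← map_val_psiSigmaTilde (K := K)] at hρ hj
  have halg : IsAlgebraic (algebraicClosure K M) ((a : M) / b) := by
    have hP := mem_span_evalGL_psiSigmaTilde (K := K) (Ψ := Ψ) (M := M)
    refine isAlgebraic_div_of_forall_translation_eq (Ω := algebraicClosure F M)
      (E := algebraicClosure K M) hP (universalPoint F K Ψ) ρ hρ j hj hb fun φ => ?_
    rw [map_val_psiSigmaTilde] at hρ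
    obtain ⟨θ, hθρ, hθ⟩ := exists_translation hρ φ
    obtain ⟨τ, hτ, hτf⟩ := hf _ (mem_galoisPoints_iff.mpr ⟨φ, rfl⟩)
    have hτ' := (isInducedBy_iff hθ).mp hτ
    have h1 := algEquiv_adjoin_apply_div τ θ hτ' f a b hab
    have hb0 : (b : M) ≠ 0 := fun h => hb (Subtype.ext h)
    have hb1 : θ b ≠ 0 := by
      rw [← hτ' b]
      intro h
      have h2 := (map_eq_zero_iff τ τ.injective).mp (Subtype.ext h)
      exact hb0 (congrArg Subtype.val h2)
    have hfix : (a : M) / b = θ a / θ b := by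
      rw [← hab, ← h1]
      exact (congrArg Subtype.val hτf).symm
    have h2 := ((div_eq_div_iff hb0 hb1).mp hfix).symm
    rw [hθρ, hθρ] at h2
    exact h2
  rw [← hab] at halg
  have : IsAlgebraic K (f : M) := halg.restrictScalars K
  exact ⟨⟨f, mem_algebraicClosure_iff.mpr this⟩, rfl⟩

end Action

end DifferenceGalois

end

theorem theorem4p4
    {L : Type*} [Field L] (σ : L ≃+* L) (F K : Subfield L)
    (hadm : DifferenceGalois.IsAdmissible σ F K)
    {r : ℕ} (Φ : GL (Fin r) K) (Ψ : GL (Fin r) L)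
    (hΨ : DifferenceGalois.IsFundamental K Ψ σ Φ)
    -- `K` is algebraically closed in `Λ = K(Ψ)`
    (hK : algebraicClosure K (DifferenceGalois.lambdaField K Ψ) = ⊥)
    -- `M` is an algebraic closure of `L`, with an extension `σM` of `σ`
    {M : Type*} [Field M] [Algebra L M] [IsAlgClosure L M] (σM : M ≃+* M)
    (hσM : ∀ x : L, σM (algebraMap L M x) = algebraMap L M (σ x))
    (hadmM : ∀ n : ℕ, 1 ≤ n → DifferenceGalois.IsAdmissible (σM ^ n)
      (DifferenceGalois.fixedSubfield (σM ^ n)) (algebraicClosure K M).toSubfield)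
    (hF : (algebraicClosure F M : Set M) =
      ⋃ n : ℕ, ⋃ _ : 1 ≤ n, (DifferenceGalois.fixedSubfield (σM ^ n) : Set M)) :
    -- the coordinate ring of `Z_{K̄}` is a subring of `M`
    Function.Injective (DifferenceGalois.sigmaTildeMap K Ψ M) ∧
    -- `Γ(F̄)` acts on `Λ̃ / K̄`
    (∃! act, DifferenceGalois.IsGaloisAction F K Ψ M act) ∧
    ∀ act, DifferenceGalois.IsGaloisAction F K Ψ M act →
      -- the subfield of `Λ̃` fixed by `Γ(F̄)` is `K̄`
      {f : DifferenceGalois.lambdaTilde K Ψ M | ∀ γ, act γ f = f} =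
        Set.range (algebraMap (algebraicClosure K M) (DifferenceGalois.lambdaTilde K Ψ M)) ∧
      -- the elements of `Λ` fixed by `Γ(F̄)` are precisely those of `K`
      {x : DifferenceGalois.lambdaField K Ψ |
          ∀ γ, act γ (DifferenceGalois.lambdaIncl K Ψ M x) =
            DifferenceGalois.lambdaIncl K Ψ M x} =
        Set.range (algebraMap K (DifferenceGalois.lambdaField K Ψ)) := by
  have := hadm.separable
  have hinj : Function.Injective (DifferenceGalois.sigmaTildeMap K Ψ M) :=
    DifferenceGalois.sigmaTildeMap_injective hK
  have : IsAlgClosed M := IsAlgClosure.isAlgClosed L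
  have hfix : ∀ act, DifferenceGalois.IsGaloisAction F K Ψ M act → ∀ f, (∀ γ, act γ f = f) →
      f ∈ Set.range (algebraMap (algebraicClosure K M) (DifferenceGalois.lambdaTilde K Ψ M)) :=
    fun act hact f hf => DifferenceGalois.mem_range_of_forall_isInducedBy hadm hΨ hinj f
      fun γ hγ => ⟨act ⟨γ, hγ⟩, hact ⟨γ, hγ⟩, hf ⟨γ, hγ⟩⟩
  refine ⟨hinj, ?_, fun act hact => ⟨?_, ?_⟩⟩
  · choose act hact using fun γ : DifferenceGalois.galoisPoints F K Ψ (algebraicClosure F M) =>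
      DifferenceGalois.exists_isInducedBy hadm hΨ hinj γ.2
    exact ⟨act, hact, fun act' hact' => funext fun γ =>
      DifferenceGalois.isInducedBy_unique hadm hΨ hinj γ.2 (hact' γ) (hact γ)⟩
  · refine Set.Subset.antisymm (fun f hf => hfix act hact f hf) ?_
    rintro _ ⟨c, rfl⟩ γ
    exact (act γ).commutes c
  · refine Set.Subset.antisymm (fun x hx => ?_) ?_
    · obtain ⟨c, hc⟩ := hfix act hact _ hx
      have hc' : (c : M) = algebraMap L M x := congrArg Subtype.val hc
      have hx : IsAlgebraic K (algebraMap (DifferenceGalois.lambdaField K Ψ) M x) := by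
        have h := mem_algebraicClosure_iff.mp c.2
        rw [hc'] at h
        exact h
      have hx' : x ∈ algebraicClosure K (DifferenceGalois.lambdaField K Ψ) :=
        mem_algebraicClosure_iff.mpr ((isAlgebraic_algebraMap_iff
          (algebraMap (DifferenceGalois.lambdaField K Ψ) M).injective).mp hx)
      rw [hK] at hx'
      exact IntermediateField.mem_bot.mp hx'
    · rintro _ ⟨k, rfl⟩ γ
      exact (act γ).commutes (algebraMap K (algebraicClosure K M) k)
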